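/- Notation. Let $d,I,J,L$ be non-negative integers and let all functions below map $\mathbb R^{d}$ to $\overline{\mathbb R}=[-\infty,+\infty]$. A function is proper if it never equals $-\infty$ and is not identically $+\infty$; it is closed if it is lower semicontinuous and either nowhere or everywhere equal to $-\infty$. For $f$ proper, closed and convex put $f^*(w)=\sup_x\{x^\top w-f(x)\}$ and define its perspective by $t f(x/t)$ for $t>0$ and $0f(x/0):=\sup\{x^\top w: f^*(w)<+\infty\}$; if $-f$ is proper, closed and convex, then $0f(x/0):=-\sup\{x^\top w: (-f)^*(w)<+\infty\}$. Let $c_\ell$ ($1\le\ell\le L$), $h_j$ ($1\le j\le J$) and $-g_i$ ($1\le i\le I$) be proper, closed and convex, let $\mu\in\mathbb R^J$, $g=\max_i g_i$ and $S=\{z: c_\ell(z)\le 0\ \forall \ell\}$. Let $\mathcal P$ be the set of Borel probability measures $P$ on $\mathbb R^d$ that are supported on $S$ (that is, $P(\mathbb R^d\setminus S)=0$) and satisfy $\mathbb E_P[h_j]\le\mu_j$ for all $j$. Expectations are those of the positive part minus those of the negative part; if both are infinite, then $\mathbb E_P[h_j]:=+\infty$ and $\mathbb E_P[g]:=-\infty$.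 Consider $$\text{(P-UQ)}\qquad \sup_{P\in\mathcal P}\mathbb E_P[g],$$ where $P\in\mathcal P$ is feasible if $\mathbb E_P[g]\neq-\infty$, and the finite convex program in the variables $\tau,\lambda\in\mathbb R^I$, $\omega_i\in\mathbb R^J$, $\upsilon_i\in\mathbb R^d$ $$\text{(AD-B')}\qquad \sup\Big\{\sum_i\tau_i \ :\ \sum_i\lambda_i=1,\ \sum_i\omega_i\le\mu,\ \lambda_i c_\ell(\upsilon_i/\lambda_i)\le 0,\ \lambda_i h_j(\upsilon_i/\lambda_i)\le\omega_{ij},\ \lambda_i g_i(\upsilon_i/\lambda_i)\ge\tau_i\ \ \forall i,j,\ell,\ \ \lambda\ge 0\Big\}.$$ Regard the constraint functions of (AD-B') (right-hand sides moved to the left, so that the constraints read $\le 0$ or $=0$) as functions on the set $\{\lambda\ge 0\}$. A Slater point of (AD-B') is a point that satisfies all constraints, lies in the relative interior of the domain $\{<+\infty\}$ of every constraint function and of the negative objective function, and satisfies strictly every inequality constraint whose function is not affine on $\{\lambda\ge0\}$. The supremum of an infeasible problem is $-\infty$. For $\varepsilon>0$, a feasible solution of a maximization problem is $\varepsilon$-optimal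 if its objective value is at least the supremum minus $\varepsilon$ or, when the supremum is $+\infty$, at least $1/\varepsilon$. Statement. Suppose that (AD-B') has a Slater point $(\tau^{S},\lambda^{S},\omega^{S},\upsilon^{S})$ with $\lambda^{S}_i>0$ for all $i$. Then the suprema of (P-UQ) and (AD-B') coincide. Moreover, for every $\varepsilon>0$, any $\varepsilon$-optimal solution $(\tau,\lambda,\omega,\upsilon)$ of (AD-B') yields a discrete distribution with $I$ atoms (counted with multiplicity) that is $2\varepsilon$-optimal in (P-UQ), in the following way: there is $\theta_0\in(0,1]$ such that for every $\theta\in(0,\theta_0]$ the convex combination $$(\tau^\theta,\lambda^\theta,\omega^\theta,\upsilon^\theta)=\theta\,(\tau^{S},\lambda^{S},\omega^{S},\upsilon^{S})+(1-\theta)\,(\tau,\lambda,\omega,\upsilon)$$ satisfies $\lambda^\theta_i>0$ for all $i$, and the discrete distribution $\sum_{i=1}^I\lambda_i^\theta\,\delta_{\upsilon_i^\theta/\lambda_i^\theta}$ is a $2\varepsilon$-optimal solution of (P-UQ). -/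

import Mathlib

open scoped ENNReal

noncomputable section

namespace UncertaintyQuantification

/-! ### Convex analysis for extended real-valued functions -/

/-- A function with values in the extended reals is *proper* if it never takes the value `-∞` and
is not identically `+∞`. -/
def IsProper {V : Type*} (f : V → EReal) : Prop :=
  (∀ x, f x ≠ ⊥) ∧ ∃ x, f x ≠ ⊤

/-- A function is *closed* if it is lower semicontinuous and either never `-∞` or identically
`-∞`. -/
def IsClosedFun {V : Type*} [TopologicalSpace V] (f : V → EReal) : Prop :=
  LowerSemicontinuous f ∧ ((∀ x, f x ≠ ⊥) ∨ ∀ x, f x = ⊥)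

/-- A function with values in the extended reals is *convex* if its epigraph is convex. -/
def IsConvexFun {V : Type*} [AddCommGroup V] [Module ℝ V] (f : V → EReal) : Prop :=
  Convex ℝ {p : V × ℝ | f p.1 ≤ (p.2 : EReal)}

/-- Proper, closed and convex. -/
structure ProperClosedConvex {V : Type*} [AddCommGroup V] [Module ℝ V] [TopologicalSpace V]
    (f : V → EReal) : Prop where
  proper : IsProper f
  closed : IsClosedFun f
  convex : IsConvexFun f

/-- The conjugate `f^*(w) = sup_x { ⟨x, w⟩ - f(x) }`. -/
def conjugate {V : Type*} [NormedAddCommGroup V] [InnerProductSpace ℝ V] (f : V → EReal)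
    (w : V) : EReal :=
  ⨆ x : V, ((inner ℝ x w : ℝ) : EReal) - f x

/-- The support function `δ^*_A(x) = sup_{w ∈ A} ⟨x, w⟩` of a set `A`. -/
def supportFun {V : Type*} [NormedAddCommGroup V] [InnerProductSpace ℝ V] (A : Set V)
    (x : V) : EReal :=
  ⨆ w ∈ A, ((inner ℝ x w : ℝ) : EReal)

/-- The convex perspective of `f`, defined for `t ≥ 0`: it equals `t f(x / t)` if `t > 0`, and the
support function of the domain of `f^*` at `x` if `t = 0`. (It is never used for `t < 0`.) -/
def convexPerspective {V : Type*} [NormedAddCommGroup V] [InnerProductSpace ℝ V] (f : V → EReal)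
    (x : V) (t : ℝ) : EReal :=
  if 0 < t then (t : EReal) * f (t⁻¹ • x)
  else supportFun {w : V | conjugate f w < ⊤} x

/-- The concave perspective of `f`, defined for `t ≥ 0`: it equals `t f(x / t)` if `t > 0`, and
minus the support function of the domain of `(-f)^*` at `x` if `t = 0`. (It is never used for
`t < 0`.) -/
def concavePerspective {V : Type*} [NormedAddCommGroup V] [InnerProductSpace ℝ V] (f : V → EReal)
    (x : V) (t : ℝ) : EReal :=
  if 0 < t then (t : EReal) * f (t⁻¹ • x)
  else - supportFun {w : V | conjugate (fun z => - f z) w < ⊤} x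

/-! ### Maximization problems, approximate solutions and Slater points -/

/-- The supremum of the objective `obj` over the set `F` (it is `-∞` if `F` is empty). -/
def supValue {X : Type*} (F : Set X) (obj : X → EReal) : EReal :=
  ⨆ x ∈ F, obj x

/-- `x` is an `ε`-optimal solution of `sup {obj x | x ∈ F}`: it is feasible, and its objective value
is at least the supremum minus `ε` or, if the supremum is `+∞`, at least `1 / ε`. -/
def IsEpsOptimal {X : Type*} (F : Set X) (obj : X → EReal) (ε : ℝ) (x : X) : Prop :=
  x ∈ F ∧ (supValue F obj ≠ ⊤ → supValue F obj - (ε : EReal) ≤ obj x) ∧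
    (supValue F obj = ⊤ → ((1 / ε : ℝ) : EReal) ≤ obj x)

/-- A maximization problem over `x ∈ ground ⊆ V` with objective `obj`, inequality constraints
`ineq k x ≤ 0` and equality constraints `eq m x = 0`. The functions are regarded as
functions on `ground`; their values outside `ground` play no role. -/
structure MaxProgram (V ι κ : Type*) where
  ground : Set V
  obj : V → EReal
  ineq : ι → V → EReal
  eq : κ → V → EReal

namespace MaxProgram

variable {V ι κ : Type*}

/-- The points satisfying all constraints. -/
def constraintSet (Q : MaxProgram V ι κ) : Set V :=
  {x | x ∈ Q.ground ∧ (∀ k, Q.ineq k x ≤ 0) ∧ ∀ m, Q.eq m x = 0}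

/-- The feasible region: all constraints hold and the objective is not `-∞`. -/
def feasible (Q : MaxProgram V ι κ) : Set V :=
  {x | x ∈ Q.constraintSet ∧ Q.obj x ≠ ⊥}

/-- The domain `{x ∈ ground | f x < +∞}` of a function on the ground set. -/
def dom (Q : MaxProgram V ι κ) (f : V → EReal) : Set V :=
  {x | x ∈ Q.ground ∧ f x < ⊤}

/-- `f` is linear (that is, affine and finite) on the ground set. -/
def IsLinear [AddCommGroup V] [Module ℝ V] (Q : MaxProgram V ι κ) (f : V → EReal) : Prop :=
  ∃ a : V →ᵃ[ℝ] ℝ, ∀ x ∈ Q.ground, f x = ((a x : ℝ) : EReal)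

/-- `x` is a Slater point of the problem: it satisfies all constraints, it lies in the relative
interior of the domain of every constraint function and of minus the objective function, and it
satisfies every nonlinear inequality constraint strictly. -/
structure IsSlaterPoint [AddCommGroup V] [Module ℝ V] [TopologicalSpace V]
    (Q : MaxProgram V ι κ) (x : V) : Prop where
  ri_ineq : ∀ k, x ∈ intrinsicInterior ℝ (Q.dom (Q.ineq k))
  ri_eq : ∀ m, x ∈ intrinsicInterior ℝ (Q.dom (Q.eq m))
  mem : x ∈ Q.constraintSet
  strict : ∀ k, ¬ Q.IsLinear (Q.ineq k) → Q.ineq k x < 0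
  ri_obj : x ∈ intrinsicInterior ℝ (Q.dom (fun y => - Q.obj y))

end MaxProgram

/-! ### The uncertainty quantification problem -/

/-- The expectation of an extended real-valued function under `P`: the integral of the positive part
minus the integral of the negative part, or `conv` if both are infinite. -/
def expectation {Ω : Type*} [MeasurableSpace Ω] (conv : EReal) (P : MeasureTheory.Measure Ω)
    (f : Ω → EReal) : EReal :=
  open Classical in
  if (∫⁻ z, (f z).toENNReal ∂P) = ⊤ ∧ (∫⁻ z, (- f z).toENNReal ∂P) = ⊤ then conv
  else ((∫⁻ z, (f z).toENNReal ∂P : ℝ≥0∞) : EReal) - ((∫⁻ z, (- f z).toENNReal ∂P : ℝ≥0∞) : EReal)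

/-- The data: support constraint functions `c`, moment functions `h`, components `g` of the
disutility function, and moment bounds `μ`. -/
structure Data (d I J L : ℕ) where
  c : Fin L → EuclideanSpace ℝ (Fin d) → EReal
  h : Fin J → EuclideanSpace ℝ (Fin d) → EReal
  g : Fin I → EuclideanSpace ℝ (Fin d) → EReal
  μ : Fin J → ℝ

/-- The variables `(τ, λ, ω, υ)` of the finite convex program. -/
abbrev Var (d I J : ℕ) : Type :=
  (Fin I → ℝ) × (Fin I → ℝ) × (Fin I → Fin J → ℝ) × (Fin I → EuclideanSpace ℝ (Fin d))

namespace Var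

variable {d I J : ℕ}

/-- The variable `τ`. -/
def tau (x : Var d I J) (i : Fin I) : ℝ := x.1 i

/-- The variable `λ`. -/
def lam (x : Var d I J) (i : Fin I) : ℝ := x.2.1 i

/-- The variable `ω`. -/
def omega (x : Var d I J) (i : Fin I) (j : Fin J) : ℝ := x.2.2.1 i j

/-- The variable `υ`. -/
def ups (x : Var d I J) (i : Fin I) : EuclideanSpace ℝ (Fin d) := x.2.2.2 i

/-- The discrete measure that assigns mass `λ i` to the point `υ i / λ i` for every `i`. -/
def discrete (x : Var d I J) : MeasureTheory.Measure (EuclideanSpace ℝ (Fin d)) :=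
  ∑ i, ENNReal.ofReal (lam x i) • MeasureTheory.Measure.dirac ((lam x i)⁻¹ • ups x i)

end Var

/-- Names of the inequality constraints of the finite convex program. -/
inductive Ineq (I J L : ℕ) : Type
  | total (j : Fin J)
  | support (i : Fin I) (l : Fin L)
  | moment (i : Fin I) (j : Fin J)
  | disutility (i : Fin I)

namespace Data

variable {d I J L : ℕ}

/-- The functions `c l`, `h j` and `- g i` are proper, closed and convex. -/
structure Regular (D : Data d I J L) : Prop where
  c_reg : ∀ l, ProperClosedConvex (D.c l)
  h_reg : ∀ j, ProperClosedConvex (D.h j)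
  g_reg : ∀ i, ProperClosedConvex (fun z => - D.g i z)

/-- The support set `S`. -/
def supportSet (D : Data d I J L) : Set (EuclideanSpace ℝ (Fin d)) :=
  {z | ∀ l, D.c l z ≤ 0}

/-- The disutility function `g = max_i g_i`. -/
def disutility (D : Data d I J L) (z : EuclideanSpace ℝ (Fin d)) : EReal :=
  ⨆ i, D.g i z

/-- The ambiguity set: probability distributions supported on `S` with
`E_P[h_j] ≤ μ_j` for all `j`, where the expectation of `h_j` is `+∞` if it is not defined. -/
def ambiguitySet (D : Data d I J L) : Set (MeasureTheory.Measure (EuclideanSpace ℝ (Fin d))) :=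
  {P | MeasureTheory.IsProbabilityMeasure P ∧ P (D.supportSet)ᶜ = 0 ∧
    ∀ j, expectation ⊤ P (D.h j) ≤ (D.μ j : EReal)}

/-- The expected disutility, which is `-∞` if it is not defined. -/
def uqObj (D : Data d I J L) (P : MeasureTheory.Measure (EuclideanSpace ℝ (Fin d))) : EReal :=
  expectation ⊥ P D.disutility

/-- The feasible region of the uncertainty quantification problem. -/
def uqFeasible (D : Data d I J L) : Set (MeasureTheory.Measure (EuclideanSpace ℝ (Fin d))) :=
  {P | P ∈ D.ambiguitySet ∧ D.uqObj P ≠ ⊥}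

/-- The inequality constraint functions of the finite convex program, one for each of
`∑ i, ω i j ≤ μ j`, `λ i c_l(υ i / λ i) ≤ 0`, `λ i h_j(υ i / λ i) ≤ ω i j` and
`λ i g_i(υ i / λ i) ≥ τ i`. -/
def ineqFun (D : Data d I J L) : Ineq I J L → Var d I J → EReal
  | .total j, x => ((∑ i, x.omega i j - D.μ j : ℝ) : EReal)
  | .support i l, x => convexPerspective (D.c l) (x.ups i) (x.lam i)
  | .moment i j, x => convexPerspective (D.h j) (x.ups i) (x.lam i) - (x.omega i j : EReal)
  | .disutility i, x => (x.tau i : EReal) - concavePerspective (D.g i) (x.ups i) (x.lam i)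

/-- The finite convex program: maximize `∑ i, τ i` over `(τ, λ, ω, υ)` with `λ ≥ 0`, subject to
`∑ i, λ i = 1` and the above inequality constraints. -/
def finiteProgram (D : Data d I J L) : MaxProgram (Var d I J) (Ineq I J L) Unit where
  ground := {x | ∀ i, 0 ≤ x.lam i}
  obj := fun x => ((∑ i, x.tau i : ℝ) : EReal)
  ineq := D.ineqFun
  eq := fun _ x => ((∑ i, x.lam i - 1 : ℝ) : EReal)

end Data

end UncertaintyQuantification

end

/-! Both inequalities rest on one description of the perspective. A proper closed convex `f` is the
supremum of its affine minorants `⟨·, w⟩ - b`, so for every `t ≥ 0` the bound `t f(v/t) ≤ r` means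
`⟨v, w⟩ - b t ≤ r` for all these minorants (`convexPerspective_le_iff`). This is a family of linear
inequalities in `(v, t, r)`, with `t = 0` included. Convexity of the feasible region and a Jensen
inequality for finite sums follow at once.

From a measure to a feasible point: the moment functions and `-g` are replaced by real integrable
majorants that still obey the moment bounds (`exists_integrable_ge`). In finite dimension a mean
lies in the convex hull itself, not only in its closure, so a finitely supported probability
reproduces all these integrals exactly while staying on the set where every pointwise bound holds
(`exists_finite_quadrature`). Grouping its atoms by an index `i` at which `g_i` attains the maximum,
and aggregating each group by Jensen, gives a feasible point.

From a feasible point to a measure: if all weights are positive, the atoms `υ_i / λ_i` with masses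
`λ_i` form a feasible distribution whose value is at least `∑ τ_i`. Mixing in a little of the Slater
point makes all weights positive at an arbitrarily small cost in the objective. -/

namespace UncertaintyQuantification

/-! ### Affine minorants and perspectives -/

section Duality

variable {V : Type*} [NormedAddCommGroup V] [InnerProductSpace ℝ V]

/-- The affine function `⟨·, w⟩ - b` lies below `f`. -/
def IsAffineMinorant (f : V → EReal) (w : V) (b : ℝ) : Prop :=
  ∀ z, ((inner ℝ z w - b : ℝ) : EReal) ≤ f z

theorem conjugate_le_coe_iff {f : V → EReal} {w : V} {b : ℝ} :
    conjugate f w ≤ (b : EReal) ↔ IsAffineMinorant f w b := by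
  unfold conjugate IsAffineMinorant
  rw [iSup_le_iff]
  refine forall_congr' fun z => ?_
  rw [EReal.coe_sub, EReal.sub_le_iff_le_add (by simp) (by simp),
    EReal.sub_le_iff_le_add (by simp) (by simp), add_comm]

theorem conjugate_lt_top_iff {f : V → EReal} {w : V} :
    conjugate f w < ⊤ ↔ ∃ b, IsAffineMinorant f w b := by
  constructor
  · intro h
    obtain ⟨b, hb, -⟩ := EReal.lt_iff_exists_real_btwn.1 h
    exact ⟨b, conjugate_le_coe_iff.1 hb.le⟩
  · rintro ⟨b, hb⟩
    exact (conjugate_le_coe_iff.2 hb).trans_lt (EReal.coe_lt_top b)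

theorem concavePerspective_eq_neg (f : V → EReal) (v : V) (t : ℝ) :
    concavePerspective f v t = - convexPerspective (fun z => - f z) v t := by
  unfold concavePerspective convexPerspective
  split_ifs <;> simp [mul_comm]

theorem isClosed_epigraph {V : Type*} [TopologicalSpace V] {f : V → EReal} (hf : LowerSemicontinuous f) :
    IsClosed {p : V × ℝ | f p.1 ≤ (p.2 : EReal)} := by
  have h := lowerSemicontinuous_iff_isClosed_epigraph.1 hf
  exact h.preimage (f := fun p : V × ℝ => (p.1, (p.2 : EReal)))
    (continuous_fst.prodMk (continuous_coe_real_ereal.comp continuous_snd))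

variable [CompleteSpace V]

/-- A point strictly below the graph is strictly separated from the epigraph. -/
theorem exists_separating {f : V → EReal} (hf : ProperClosedConvex f) {x : V} {a : ℝ}
    (ha : (a : EReal) < f x) :
    ∃ (w : V) (k u : ℝ), 0 ≤ k ∧ inner ℝ x w + a * k < u ∧
      ∀ (y : V) (s : ℝ), f y ≤ (s : EReal) → u < inner ℝ y w + s * k := by
  obtain ⟨L, u, h1, h2⟩ := geometric_hahn_banach_point_closed hf.convex
    (isClosed_epigraph hf.closed.1) (x := (x, a)) (by simpa using ha)
  have hL : ∀ (y : V) (s : ℝ), L (y, s) =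
      inner ℝ y ((InnerProductSpace.toDual ℝ V).symm (L.comp (.inl ℝ V ℝ))) + s * L (0, 1) := by
    intro y s
    rw [real_inner_comm, InnerProductSpace.toDual_symm_apply, ← smul_eq_mul, ← map_smul]
    simp [← map_add]
  refine ⟨(InnerProductSpace.toDual ℝ V).symm (L.comp (.inl ℝ V ℝ)), L (0, 1), u, ?_,
    by rw [← hL]; exact h1, fun y s hs => by rw [← hL]; exact h2 (y, s) hs⟩
  obtain ⟨y, hy⟩ := hf.proper.2
  -- The epigraph is unbounded upwards, so a negative slope `k` would violate the separation at a
  -- large enough height `s'` above a point of the domain.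
  by_contra! hk
  set w := (InnerProductSpace.toDual ℝ V).symm (L.comp (.inl ℝ V ℝ))
  obtain ⟨s, hs, -⟩ := EReal.lt_iff_exists_real_btwn.1 (lt_top_iff_ne_top.2 hy)
  set s' := max s ((u - inner ℝ y w) / L (0, 1)) with hs'
  have h3 := h2 (y, s') (hs.le.trans (by exact_mod_cast le_max_left _ _))
  rw [hL] at h3
  have h4 : (u - inner ℝ y w) / L (0, 1) ≤ s' := le_max_right _ _
  rw [div_le_iff_of_neg hk] at h4
  linarith

/-- A proper closed convex function is the supremum of its affine minorants. -/
theorem exists_affineMinorant {f : V → EReal} (hf : ProperClosedConvex f) {x : V} {a : ℝ}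
    (ha : (a : EReal) < f x) :
    ∃ w b, IsAffineMinorant f w b ∧ a < inner ℝ x w - b := by
  -- A non-vertical separating hyperplane is the graph of an affine minorant after division by `k`.
  have key : ∀ {x : V} {a : ℝ} {w : V} {k u : ℝ}, 0 < k → inner ℝ x w + a * k < u →
      (∀ (y : V) (s : ℝ), f y ≤ (s : EReal) → u < inner ℝ y w + s * k) →
      ∃ w b, IsAffineMinorant f w b ∧ a < inner ℝ x w - b := by
    intro x a w k u hk h1 h2
    refine ⟨-(k⁻¹ • w), -(k⁻¹ * u), fun z => ?_, ?_⟩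
    · refine EReal.le_of_forall_lt_iff_le.1 fun s hs => ?_
      have h3 := h2 z s hs.le
      rw [inner_neg_right, real_inner_smul_right]
      norm_cast
      have : k⁻¹ * u < k⁻¹ * (inner ℝ z w + s * k) := by gcongr
      field_simp at this ⊢
      linarith
    · rw [inner_neg_right, real_inner_smul_right]
      have : k⁻¹ * (inner ℝ x w + a * k) < k⁻¹ * u := by gcongr
      field_simp at this ⊢
      linarith
  obtain ⟨w, k, u, hk, h1, h2⟩ := exists_separating hf ha
  rcases hk.lt_or_eq with hk | rfl
  · exact key hk h1 h2
  -- Vertical case. At a point of the domain, separating height `r - 1` from the epigraph forces a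
  -- positive slope, so some minorant exists. Adding `t (u - ⟨·, w⟩)` to it keeps it a minorant,
  -- since this term is nonpositive on the domain of `f`. The term is positive at `x` for `t > 0`,
  -- and a large `t` lifts the value there above `a`.
  obtain ⟨x₀, hx₀⟩ := hf.proper.2
  lift f x₀ to ℝ using ⟨hx₀, hf.proper.1 x₀⟩ with r hr
  obtain ⟨w₀, b₀, h₀⟩ : ∃ w₀ b₀, IsAffineMinorant f w₀ b₀ := by
    obtain ⟨w', k', u', hk', h1', h2'⟩ := exists_separating hf (x := x₀) (a := r - 1)
      (by rw [← hr]; norm_cast; linarith)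
    have h3' := h2' x₀ r hr.symm.le
    obtain ⟨w₀, b₀, h, -⟩ := key (x := x₀) (a := r - 1) (by nlinarith) h1' h2'
    exact ⟨w₀, b₀, h⟩
  simp only [mul_zero, add_zero] at h1 h2
  set t := max 0 ((a + 1 - (inner ℝ x w₀ - b₀)) / (u - inner ℝ x w)) with ht
  have ht0 : 0 ≤ t := le_max_left _ _
  refine ⟨w₀ - t • w, b₀ - t * u, fun z => ?_, ?_⟩
  · refine EReal.le_of_forall_lt_iff_le.1 fun s hs => ?_
    have h3 := h2 z s hs.le
    have h4 : inner ℝ z w₀ - b₀ ≤ s := by exact_mod_cast (h₀ z).trans hs.le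
    rw [inner_sub_right, real_inner_smul_right]
    norm_cast
    nlinarith
  · have h5 : (a + 1 - (inner ℝ x w₀ - b₀)) / (u - inner ℝ x w) ≤ t := le_max_right _ _
    rw [div_le_iff₀ (by linarith)] at h5
    rw [inner_sub_right, real_inner_smul_right]
    linarith

theorem coe_mul_le_coe_iff {t r : ℝ} (ht : 0 < t) {y : EReal} :
    (t : EReal) * y ≤ (r : EReal) ↔ y ≤ ((t⁻¹ * r : ℝ) : EReal) := by
  induction y with
  | bot => simp [EReal.coe_mul_bot_of_pos ht]
  | top =>
    rw [EReal.coe_mul_top_of_pos ht]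
    exact iff_of_false (by simp) (by rw [top_le_iff]; exact EReal.coe_ne_top _)
  | coe y => norm_cast; rw [← div_eq_inv_mul, le_div_iff₀' ht]

/-- The sublevel sets of the perspective are cut out by the affine minorants. -/
theorem convexPerspective_le_iff {f : V → EReal} (hf : ProperClosedConvex f) {v : V} {t r : ℝ}
    (ht : 0 ≤ t) :
    convexPerspective f v t ≤ (r : EReal) ↔
      ∀ w b, IsAffineMinorant f w b → inner ℝ v w - b * t ≤ r := by
  unfold convexPerspective
  rcases ht.lt_or_eq with ht | rfl
  · rw [if_pos ht, coe_mul_le_coe_iff ht]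
    constructor
    · intro h w b hw
      have h1 := (hw _).trans h
      rw [real_inner_smul_left] at h1
      norm_cast at h1
      field_simp at h1
      linarith
    · intro h
      by_contra! hlt
      obtain ⟨w, b, hw, h1⟩ := exists_affineMinorant hf hlt
      have h2 := h w b hw
      rw [real_inner_smul_left] at h1
      field_simp at h1
      linarith
  -- The domain of the conjugate consists exactly of the slopes of affine minorants, and at `t = 0`
  -- the constants `b` drop out.
  · rw [if_neg (lt_irrefl _), supportFun]
    simp only [iSup_le_iff, Set.mem_ofPred_eq, conjugate_lt_top_iff, mul_zero, sub_zero]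
    constructor
    · intro h w b hw
      exact_mod_cast h w ⟨b, hw⟩
    · rintro h w ⟨b, hw⟩
      exact_mod_cast h w b hw

theorem convexPerspective_combo_le {f : V → EReal} (hf : ProperClosedConvex f) {v v' : V}
    {t t' r r' θ : ℝ} (ht : 0 ≤ t) (ht' : 0 ≤ t') (h0 : 0 ≤ θ) (h1 : θ ≤ 1)
    (h : convexPerspective f v t ≤ (r : EReal)) (h' : convexPerspective f v' t' ≤ (r' : EReal)) :
    convexPerspective f (θ • v + (1 - θ) • v') (θ * t + (1 - θ) * t') ≤
      ((θ * r + (1 - θ) * r' : ℝ) : EReal) := by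
  have h1' : 0 ≤ 1 - θ := by linarith
  rw [convexPerspective_le_iff hf ht] at h
  rw [convexPerspective_le_iff hf ht'] at h'
  rw [convexPerspective_le_iff hf (by positivity)]
  intro w b hw
  have := mul_le_mul_of_nonneg_left (h w b hw) h0
  have := mul_le_mul_of_nonneg_left (h' w b hw) h1'
  rw [inner_add_left, real_inner_smul_left, real_inner_smul_left]
  linarith

/-- Jensen's inequality, obtained by averaging each minorant inequality with the weights `q`. The
total weight may be zero. -/
theorem convexPerspective_sum_le {ι : Type*} {s : Finset ι} {f : V → EReal}
    (hf : ProperClosedConvex f) {q a : ι → ℝ} {z : ι → V} (hq : ∀ k ∈ s, 0 ≤ q k)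
    (h : ∀ k ∈ s, q k ≠ 0 → f (z k) ≤ (a k : EReal)) :
    convexPerspective f (∑ k ∈ s, q k • z k) (∑ k ∈ s, q k) ≤ ((∑ k ∈ s, q k * a k : ℝ) : EReal) := by
  rw [convexPerspective_le_iff hf (Finset.sum_nonneg hq)]
  intro w b hw
  rw [sum_inner, Finset.mul_sum, ← Finset.sum_sub_distrib]
  refine Finset.sum_le_sum fun k hk => ?_
  by_cases h0 : q k = 0
  · simp [h0]
  have h1 : inner ℝ (z k) w - b ≤ a k := by exact_mod_cast (hw (z k)).trans (h k hk h0)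
  have := mul_le_mul_of_nonneg_left h1 (hq k hk)
  rw [real_inner_smul_left]
  linarith

end Duality

open MeasureTheory

/-! ### Means and convex hulls in finite dimension -/

section Barycenter

/-- No closedness is needed: either the interior is nonempty and Hahn–Banach applies, or `A` lies in
a proper affine subspace and some nonzero functional is constant on `A`, nonnegative up to sign. -/
theorem exists_nonneg_functional {E : Type*} [NormedAddCommGroup E] [NormedSpace ℝ E]
    [FiniteDimensional ℝ E] {A : Set E} (hA : Convex ℝ A) (hne : A.Nonempty) (h0 : (0 : E) ∉ A) :
    ∃ f : E →L[ℝ] ℝ, f ≠ 0 ∧ ∀ a ∈ A, 0 ≤ f a := by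
  by_cases hint : (interior A).Nonempty
  · obtain ⟨f, hf, h⟩ := geometric_hahn_banach_of_nonempty_interior_point hA
      (fun h => h0 (interior_subset h)) hint
    exact ⟨-f, neg_ne_zero.2 hf, fun a ha => by simpa using h a ha⟩
  · rw [hA.interior_nonempty_iff_affineSpan_eq_top,
      AffineSubspace.affineSpan_eq_top_iff_vectorSpan_eq_top_of_nonempty ℝ E E hne] at hint
    obtain ⟨f, hf, hle⟩ := Submodule.exists_le_ker_of_lt_top _ (lt_top_iff_ne_top.2 hint)
    obtain ⟨a₀, ha₀⟩ := hne
    have hconst : ∀ a ∈ A, f a = f a₀ := fun a ha => by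
      have := hle (vsub_mem_vectorSpan ℝ ha ha₀)
      rwa [LinearMap.mem_ker, vsub_eq_sub, map_sub, sub_eq_zero] at this
    have hf' : f.toContinuousLinearMap ≠ 0 := by simpa using hf
    rcases le_total 0 (f a₀) with h | h
    · exact ⟨f.toContinuousLinearMap, hf', fun a ha => by simpa [hconst a ha] using h⟩
    · exact ⟨-f.toContinuousLinearMap, neg_ne_zero.2 hf', fun a ha => by
        simpa [hconst a ha] using h⟩

/-- Induction on the dimension. If `0` is outside the hull, a nonzero functional `f` is nonnegative
on it. Then `f ∘ X` is nonnegative almost surely with mean zero, hence vanishes almost surely, and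
`X` lives in the smaller space `ker f`. -/
theorem zero_mem_convexHull_of_integral_eq_zero {Ω : Type*} [MeasurableSpace Ω] {P : Measure Ω}
    [IsProbabilityMeasure P] (n : ℕ) : ∀ (E : Type) [NormedAddCommGroup E] [NormedSpace ℝ E]
    [FiniteDimensional ℝ E], Module.finrank ℝ E = n → ∀ (X : Ω → E) (A : Set E),
    Integrable X P → ∫ z, X z ∂P = 0 → (∀ᵐ z ∂P, X z ∈ A) → (0 : E) ∈ convexHull ℝ A := by
  induction n using Nat.strong_induction_on with
  | _ n ih =>
    intro E _ _ _ hn X A hX h0 hA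
    by_contra hmem
    have hne : (convexHull ℝ A).Nonempty := by
      obtain ⟨z, hz⟩ := hA.exists
      exact ⟨X z, subset_convexHull ℝ A hz⟩
    obtain ⟨f, hf, hpos⟩ := exists_nonneg_functional (convex_convexHull ℝ A) hne hmem
    have hfX : ∀ᵐ z ∂P, f (X z) = 0 := by
      refine (integral_eq_zero_iff_of_nonneg_ae ?_ (f.integrable_comp hX)).1 ?_
      · filter_upwards [hA] with z hz using hpos _ (subset_convexHull ℝ A hz)
      · rw [f.integral_comp_comm hX, h0, map_zero]
    set K := LinearMap.ker f.toLinearMap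
    have hK : Module.finrank ℝ K < n := by
      rw [← hn]
      refine Submodule.finrank_lt fun h => hf ?_
      ext x
      exact LinearMap.congr_fun (LinearMap.ker_eq_top.1 h) x
    -- A linear projection onto the kernel turns `X` into a `K`-valued variable and leaves it
    -- unchanged almost surely.
    obtain ⟨p, hp⟩ := K.subtype.exists_leftInverse_of_injective (Submodule.ker_subtype K)
    have hpK : ∀ x : E, f x = 0 → ((p x : K) : E) = x := fun x hx =>
      congrArg Subtype.val (LinearMap.congr_fun hp ⟨x, hx⟩)
    have key := ih _ hK K rfl (fun z => p.toContinuousLinearMap (X z)) {y | (y : E) ∈ A}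
      (p.toContinuousLinearMap.integrable_comp hX)
      (by rw [p.toContinuousLinearMap.integral_comp_comm hX, h0, map_zero])
      (by
        filter_upwards [hA, hfX] with z hz hz0
        have : ((p (X z) : K) : E) ∈ A := by rwa [hpK _ hz0]
        exact this)
    have h1 := Set.mem_image_of_mem K.subtype key
    rw [LinearMap.image_convexHull, map_zero] at h1
    exact hmem (convexHull_mono (by rintro _ ⟨y, hy, rfl⟩; exact hy) h1)

open Pointwise in
/-- In finite dimension the mean of a random vector lies in the convex hull (not only in the closed
convex hull) of any set that contains the vector almost surely. -/
theorem integral_mem_convexHull {Ω E : Type} [MeasurableSpace Ω] {P : Measure Ω}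
    [IsProbabilityMeasure P] [NormedAddCommGroup E] [NormedSpace ℝ E] [FiniteDimensional ℝ E]
    {X : Ω → E} {A : Set E} (hX : Integrable X P) (hA : ∀ᵐ z ∂P, X z ∈ A) :
    ∫ z, X z ∂P ∈ convexHull ℝ A := by
  set m := ∫ z, X z ∂P with hm
  have h := zero_mem_convexHull_of_integral_eq_zero (P := P) _ E rfl (fun z => -m + X z) (-m +ᵥ A)
    ((integrable_const _).add hX)
    (by rw [integral_add (integrable_const _) hX, ← hm]; simp)
    (by filter_upwards [hA] with z hz using Set.vadd_mem_vadd_set hz)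
  rw [convexHull_vadd] at h
  obtain ⟨y, hy, hy0⟩ := h
  rwa [← neg_add_eq_zero.1 hy0] at hy

/-- Finitely many integrals are reproduced by a probability with finite support on a set of full
measure. -/
theorem exists_finite_quadrature {Ω κ : Type} [MeasurableSpace Ω] {P : Measure Ω}
    [IsProbabilityMeasure P] [Fintype κ] {X : κ → Ω → ℝ} (hX : ∀ k, Integrable (X k) P)
    {B : Set Ω} (hB : ∀ᵐ z ∂P, z ∈ B) :
    ∃ (ι : Type) (s : Finset ι) (p : ι → ℝ) (z : ι → Ω), (∀ i ∈ s, 0 ≤ p i) ∧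
      ∑ i ∈ s, p i = 1 ∧ (∀ i ∈ s, z i ∈ B) ∧ ∀ k, ∑ i ∈ s, p i * X k (z i) = ∫ z, X k z ∂P := by
  have hint : Integrable (fun z k => X k z) P := Integrable.of_eval hX
  have h := integral_mem_convexHull hint (A := (fun z k => X k z) '' B)
    (by filter_upwards [hB] with z hz using Set.mem_image_of_mem _ hz)
  rw [convexHull_eq] at h
  obtain ⟨ι, s, p, y, hp, hp1, hy, hsum⟩ := h
  have : Nonempty Ω := ⟨hB.exists.choose⟩
  choose! z hzB hzy using hy
  refine ⟨ι, s, p, z, hp, hp1, hzB, fun k => ?_⟩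
  rw [← eval_integral hX, ← hsum, Finset.centerMass_eq_of_sum_1 _ _ hp1, Finset.sum_apply]
  refine Finset.sum_congr rfl fun i hi => ?_
  rw [← hzy i hi]
  rfl

end Barycenter

/-! ### Extended-valued expectations and integrable majorants -/

section Expectation

variable {Ω : Type*} [MeasurableSpace Ω] {P : Measure Ω}

/-- The two conventions for undefined expectations are mirror images, so `-g` can be treated as one
more moment function. -/
theorem expectation_top_neg (f : Ω → EReal) :
    expectation ⊤ P (fun z => - f z) = - expectation ⊥ P f := by
  unfold expectation
  simp only [neg_neg]
  by_cases h : (∫⁻ z, (f z).toENNReal ∂P) = ⊤ ∧ (∫⁻ z, (- f z).toENNReal ∂P) = ⊤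
  · rw [if_pos h, if_pos h.symm, EReal.neg_bot]
  · rw [if_neg h, if_neg (fun h' => h h'.symm), EReal.neg_sub]
    · rw [add_comm, sub_eq_add_neg]
    · left; simp
    · rw [not_and_or] at h
      simpa using h

theorem expectation_le_integral {f : Ω → EReal} {H : Ω → ℝ} (hH : Integrable H P)
    (h : ∀ᵐ z ∂P, f z ≤ (H z : EReal)) (hf : Measurable f) :
    expectation ⊤ P f ≤ ((∫ z, H z ∂P : ℝ) : EReal) := by
  have hHp : ∫⁻ z, ENNReal.ofReal (H z) ∂P ≠ ⊤ := hH.lintegral_lt_top.ne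
  have hHn : ∫⁻ z, ENNReal.ofReal (-H z) ∂P ≠ ⊤ := hH.neg.lintegral_lt_top.ne
  have hfn : Measurable fun z => (- f z).toENNReal := hf.neg.ereal_toENNReal
  have hA : (∫⁻ z, (f z).toENNReal ∂P) ≤ ∫⁻ z, ENNReal.ofReal (H z) ∂P := by
    refine lintegral_mono_ae ?_
    filter_upwards [h] with z hz
    exact EReal.toENNReal_le_toENNReal hz
  have hA' := ne_top_of_le_ne_top hHp hA
  unfold expectation
  rw [if_neg (fun h' => hA' h'.1), integral_eq_lintegral_pos_part_sub_lintegral_neg_part hH]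
  by_cases hB : (∫⁻ z, (- f z).toENNReal ∂P) = ⊤
  · simp [hB]
  -- The pointwise bound is rearranged as `f⁺ + H⁻ ≤ H⁺ + f⁻`, which involves no subtraction of
  -- infinite values.
  have hsum : (∫⁻ z, (f z).toENNReal ∂P) + ∫⁻ z, ENNReal.ofReal (-H z) ∂P ≤
      (∫⁻ z, ENNReal.ofReal (H z) ∂P) + ∫⁻ z, (- f z).toENNReal ∂P := by
    rw [← lintegral_add_left hf.ereal_toENNReal, ← lintegral_add_right _ hfn]
    refine lintegral_mono_ae ?_
    filter_upwards [h] with z hz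
    induction hfz : f z with
    | bot => simp
    | top => simp [hfz] at hz
    | coe r =>
      have hr : r ≤ H z := by rw [hfz] at hz; exact_mod_cast hz
      rw [← EReal.coe_neg, EReal.real_coe_toENNReal, EReal.real_coe_toENNReal]
      rcases le_total 0 r with h1 | h1 <;> rcases le_total 0 (H z) with h2 | h2
      · simp [ENNReal.ofReal_of_nonpos, h1, h2, ENNReal.ofReal_le_ofReal hr]
      · have : r = 0 := by linarith
        have : H z = 0 := by linarith
        simp [*]
      · simp [ENNReal.ofReal_of_nonpos, h1, h2]
      · simp only [ENNReal.ofReal_of_nonpos, h1, h2, zero_add]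
        exact ENNReal.ofReal_le_ofReal (by linarith)
  lift (∫⁻ z, (f z).toENNReal ∂P) to NNReal using hA' with a
  lift (∫⁻ z, (- f z).toENNReal ∂P) to NNReal using hB with b
  lift (∫⁻ z, ENNReal.ofReal (H z) ∂P) to NNReal using hHp with c
  lift (∫⁻ z, ENNReal.ofReal (- H z) ∂P) to NNReal using hHn with e
  have h3 : (a : ℝ) + e ≤ c + b := by exact_mod_cast hsum
  have h4 : ((a : ℝ) - b : ℝ) ≤ c - e := by linarith
  simp only [ENNReal.coe_toReal]
  rw [EReal.coe_nnreal_eq_coe_real, EReal.coe_nnreal_eq_coe_real]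
  exact_mod_cast h4

/-- The convention `⊤` forces `f⁺` to have a finite integral. The majorant is `f⁺ - φ` with an
integrable `φ ≤ f⁻` whose integral is large enough; such a `φ` exists even if `f⁻` has infinite
integral. -/
theorem exists_integrable_ge [IsFiniteMeasure P] {f : Ω → EReal} (hf : Measurable f) {m : ℝ}
    (h : expectation ⊤ P f ≤ (m : EReal)) :
    ∃ H : Ω → ℝ, Integrable H P ∧ (∀ᵐ z ∂P, f z ≤ (H z : EReal)) ∧ ∫ z, H z ∂P ≤ m := by
  have hA : (∫⁻ z, (f z).toENNReal ∂P) ≠ ⊤ := by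
    intro hA
    unfold expectation at h
    rw [hA] at h
    by_cases hB : (∫⁻ z, (- f z).toENNReal ∂P) = ⊤
    · rw [if_pos ⟨rfl, hB⟩] at h
      exact absurd h (by simp)
    · rw [if_neg (fun h' => hB h'.2), EReal.coe_ennreal_top, EReal.top_sub (by simpa using hB)] at h
      exact absurd h (by simp)
  obtain ⟨φ, hφm, hφle, hφtop, hφ⟩ : ∃ φ : Ω → NNReal, Measurable φ ∧
      (∀ z, (φ z : ℝ≥0∞) ≤ (- f z).toENNReal) ∧ (∫⁻ z, φ z ∂P) ≠ ⊤ ∧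
      (∫⁻ z, (f z).toENNReal ∂P).toReal - (∫⁻ z, φ z ∂P).toReal ≤ m := by
    by_cases hB : (∫⁻ z, (- f z).toENNReal ∂P) = ⊤
    -- The integral of `f⁻` is a supremum over simple functions below it, so one of them exceeds the
    -- required threshold.
    · have hlt : ENNReal.ofReal ((∫⁻ z, (f z).toENNReal ∂P).toReal - m) <
          ∫⁻ z, (- f z).toENNReal ∂P := by rw [hB]; exact ENNReal.ofReal_lt_top
      rw [lintegral_eq_nnreal (fun z => (- f z).toENNReal)] at hlt
      obtain ⟨φ, hlt⟩ := lt_iSup_iff.1 hlt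
      obtain ⟨hφ, hlt⟩ := lt_iSup_iff.1 hlt
      rw [← SimpleFunc.lintegral_eq_lintegral] at hlt
      have htop : (∫⁻ z, φ z ∂P) ≠ ⊤ := by
        obtain ⟨C, hC⟩ := φ.exists_forall_le
        refine ne_top_of_le_ne_top ?_ (lintegral_mono (g := fun _ => (C : ℝ≥0∞))
          fun z => ENNReal.coe_le_coe.2 (hC z))
        rw [lintegral_const]
        exact ENNReal.mul_ne_top ENNReal.coe_ne_top (measure_ne_top _ _)
      refine ⟨φ, φ.measurable, hφ, htop, ?_⟩
      have := (ENNReal.ofReal_le_iff_le_toReal htop).1 hlt.le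
      linarith
    · refine ⟨fun z => (- f z).toENNReal.toNNReal, hf.neg.ereal_toENNReal.ennreal_toNNReal,
        fun z => ENNReal.coe_toNNReal_le_self, ?_, ?_⟩
      · exact ne_top_of_le_ne_top hB (lintegral_mono fun z => ENNReal.coe_toNNReal_le_self)
      · have hae : (∫⁻ z, ((- f z).toENNReal.toNNReal : ℝ≥0∞) ∂P) =
            ∫⁻ z, (- f z).toENNReal ∂P := by
          refine lintegral_congr_ae ?_
          filter_upwards [ae_lt_top hf.neg.ereal_toENNReal hB] with z hz
          exact ENNReal.coe_toNNReal hz.ne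
        rw [hae]
        unfold expectation at h
        rw [if_neg (fun h' => hA h'.1)] at h
        lift (∫⁻ z, (f z).toENNReal ∂P) to NNReal using hA with a
        lift (∫⁻ z, (- f z).toENNReal ∂P) to NNReal using hB with b
        simp only [ENNReal.coe_toReal]
        rw [EReal.coe_nnreal_eq_coe_real, EReal.coe_nnreal_eq_coe_real] at h
        exact_mod_cast h
  have hint1 : Integrable (fun z => (f z).toENNReal.toReal) P :=
    integrable_toReal_of_lintegral_ne_top hf.ereal_toENNReal.aemeasurable hA
  have hint2 : Integrable (fun z => (φ z : ℝ≥0∞).toReal) P :=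
    integrable_toReal_of_lintegral_ne_top hφm.coe_nnreal_ennreal.aemeasurable hφtop
  have hfin := ae_lt_top hf.ereal_toENNReal hA
  refine ⟨fun z => (f z).toENNReal.toReal - (φ z : ℝ≥0∞).toReal, hint1.sub hint2, ?_, ?_⟩
  · filter_upwards [hfin] with z hz
    have h1 := hφle z
    induction hfz : f z with
    | bot => simp
    | top => simp [hfz] at hz
    | coe r =>
      rw [hfz, ← EReal.coe_neg, EReal.real_coe_toENNReal] at h1
      have h2 := ENNReal.toReal_mono ENNReal.ofReal_ne_top h1
      rw [ENNReal.toReal_ofReal'] at h2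
      rw [EReal.real_coe_toENNReal, ENNReal.toReal_ofReal']
      norm_cast
      rcases le_total 0 r with hr | hr
      · rw [max_eq_right (by linarith : -r ≤ 0)] at h2
        linarith [le_max_left r 0]
      · rw [max_eq_left (by linarith : 0 ≤ -r)] at h2
        linarith [le_max_right r 0]
  · rw [integral_sub hint1 hint2, integral_toReal hf.ereal_toENNReal.aemeasurable hfin,
      integral_toReal hφm.coe_nnreal_ennreal.aemeasurable (by simp)]
    exact hφ

end Expectation

/-! ### Feasible points of the finite program -/

variable {d I J L : ℕ}

/-- The constraints of the finite convex program, with all convex perspectives bounded above by real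
numbers. -/
structure IsFeasiblePoint (D : Data d I J L) (x : Var d I J) : Prop where
  lam_nonneg : ∀ i, 0 ≤ x.lam i
  sum_lam : ∑ i, x.lam i = 1
  total : ∀ j, ∑ i, x.omega i j ≤ D.μ j
  support : ∀ i l, convexPerspective (D.c l) (x.ups i) (x.lam i) ≤ ((0 : ℝ) : EReal)
  moment : ∀ i j, convexPerspective (D.h j) (x.ups i) (x.lam i) ≤ (x.omega i j : EReal)
  disutility : ∀ i, convexPerspective (fun z => - D.g i z) (x.ups i) (x.lam i) ≤
    ((- x.tau i : ℝ) : EReal)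

theorem mem_feasible_iff (D : Data d I J L) (x : Var d I J) :
    x ∈ D.finiteProgram.feasible ↔ IsFeasiblePoint D x := by
  have hdis : ∀ i, (x.tau i : EReal) - concavePerspective (D.g i) (x.ups i) (x.lam i) ≤ 0 ↔
      convexPerspective (fun z => - D.g i z) (x.ups i) (x.lam i) ≤ ((- x.tau i : ℝ) : EReal) := by
    intro i
    rw [EReal.sub_nonpos, concavePerspective_eq_neg, EReal.le_neg, EReal.coe_neg]
  constructor
  · rintro ⟨⟨h1, h2, h3⟩, -⟩
    have h3' : ((∑ i, x.lam i - 1 : ℝ) : EReal) = 0 := h3 ()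
    refine ⟨h1, ?_, fun j => ?_, fun i l => h2 (.support i l), fun i j => ?_, fun i => ?_⟩
    · have : ∑ i, x.lam i - 1 = 0 := by exact_mod_cast h3'
      linarith
    · have h : ((∑ i, x.omega i j - D.μ j : ℝ) : EReal) ≤ 0 := h2 (.total j)
      have : ∑ i, x.omega i j - D.μ j ≤ 0 := by exact_mod_cast h
      linarith
    · exact EReal.sub_nonpos.1 (h2 (.moment i j))
    · exact (hdis i).1 (h2 (.disutility i))
  · rintro ⟨h1, h2, h3, h4, h5, h6⟩
    refine ⟨⟨h1, ?_, fun _ => ?_⟩, EReal.coe_ne_bot _⟩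
    · rintro (j | ⟨i, l⟩ | ⟨i, j⟩ | i)
      · change ((∑ i, x.omega i j - D.μ j : ℝ) : EReal) ≤ 0
        have : ∑ i, x.omega i j - D.μ j ≤ 0 := sub_nonpos.2 (h3 j)
        exact_mod_cast this
      · exact h4 i l
      · exact EReal.sub_nonpos.2 (h5 i j)
      · exact (hdis i).2 (h6 i)
    · change ((∑ i, x.lam i - 1 : ℝ) : EReal) = 0
      rw [h2, sub_self]; rfl

theorem IsFeasiblePoint.combo {D : Data d I J L} (hD : D.Regular) {x y : Var d I J}
    (hx : IsFeasiblePoint D x) (hy : IsFeasiblePoint D y) {θ : ℝ} (h0 : 0 ≤ θ) (h1 : θ ≤ 1) :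
    IsFeasiblePoint D (θ • x + (1 - θ) • y) := by
  have h1' : 0 ≤ 1 - θ := by linarith
  have hlam : ∀ i, (θ • x + (1 - θ) • y).lam i = θ * x.lam i + (1 - θ) * y.lam i := fun _ => rfl
  have htau : ∀ i, (θ • x + (1 - θ) • y).tau i = θ * x.tau i + (1 - θ) * y.tau i := fun _ => rfl
  have hups : ∀ i, (θ • x + (1 - θ) • y).ups i = θ • x.ups i + (1 - θ) • y.ups i := fun _ => rfl
  have hom : ∀ i j, (θ • x + (1 - θ) • y).omega i j = θ * x.omega i j + (1 - θ) * y.omega i j :=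
    fun _ _ => rfl
  refine ⟨fun i => ?_, ?_, fun j => ?_, fun i l => ?_, fun i j => ?_, fun i => ?_⟩
  · have := hx.lam_nonneg i
    have := hy.lam_nonneg i
    rw [hlam]
    positivity
  · simp only [hlam, Finset.sum_add_distrib, ← Finset.mul_sum, hx.sum_lam, hy.sum_lam]
    ring
  · simp only [hom, Finset.sum_add_distrib, ← Finset.mul_sum]
    nlinarith [hx.total j, hy.total j]
  · have := convexPerspective_combo_le (hD.c_reg l) (hx.lam_nonneg i) (hy.lam_nonneg i) h0 h1
      (hx.support i l) (hy.support i l)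
    simpa [hlam, hups] using this
  · rw [hlam, hups, hom]
    exact convexPerspective_combo_le (hD.h_reg j) (hx.lam_nonneg i) (hy.lam_nonneg i) h0 h1
      (hx.moment i j) (hy.moment i j)
  · have := convexPerspective_combo_le (hD.g_reg i) (hx.lam_nonneg i) (hy.lam_nonneg i) h0 h1
      (hx.disutility i) (hy.disutility i)
    rw [hlam, hups, htau]
    convert this using 2
    ring

namespace Data.Regular

variable {D : Data d I J L} (hD : D.Regular)
include hD

theorem measurable_h (j : Fin J) : Measurable (D.h j) := (hD.h_reg j).closed.1.measurable

theorem measurable_neg_disutility : Measurable fun z => - D.disutility z := by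
  have h : ∀ i, Measurable (D.g i) := fun i => by
    simpa [Pi.neg_def] using (hD.g_reg i).closed.1.measurable.neg
  exact (Measurable.iSup h).neg

theorem disutility_ne_top [Nonempty (Fin I)] (z : EuclideanSpace ℝ (Fin d)) :
    D.disutility z ≠ ⊤ := by
  obtain ⟨i, hi⟩ := exists_eq_ciSup_of_finite (f := fun i => D.g i z)
  unfold disutility
  rw [← hi]
  simpa using (hD.g_reg i).proper.1 z

end Data.Regular

/-! ### From measures to feasible points -/

/-- A probability measure that is feasible in the uncertainty quantification problem can be replaced
by a feasible point of the finite convex program. -/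
theorem exists_feasiblePoint_of_lt [Nonempty (Fin I)] {D : Data d I J L} (hD : D.Regular)
    {P : Measure (EuclideanSpace ℝ (Fin d))} (hP : P ∈ D.ambiguitySet) {r : ℝ}
    (hr : (r : EReal) < D.uqObj P) :
    ∃ x : Var d I J, IsFeasiblePoint D x ∧ r ≤ ∑ i, x.tau i := by
  obtain ⟨hprob, hsupp, hmom⟩ := hP
  choose H hHint hHge hHle using fun j => exists_integrable_ge (hD.measurable_h j) (hmom j)
  obtain ⟨G, hGint, hGge, hGle⟩ := exists_integrable_ge (P := P) (m := -r)
    hD.measurable_neg_disutility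
    (by rw [expectation_top_neg, EReal.coe_neg]; exact EReal.neg_le_neg_iff.2 hr.le)
  let B : Set (EuclideanSpace ℝ (Fin d)) :=
    {z | z ∈ D.supportSet ∧ (∀ j, D.h j z ≤ (H j z : EReal)) ∧ - D.disutility z ≤ (G z : EReal)}
  have hB : ∀ᵐ z ∂P, z ∈ B := by
    have hS : ∀ᵐ z ∂P, z ∈ D.supportSet := hsupp
    filter_upwards [hS, ae_all_iff.2 hHge, hGge] with z h1 h2 h3 using ⟨h1, h2, h3⟩
  -- The index `none` carries `G`, and `some j` carries `H j`.
  obtain ⟨ι, s, p, z, hp, hp1, hzB, hquad⟩ := exists_finite_quadrature (P := P)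
    (X := fun (k : Option (Fin J)) => k.elim G H) (fun k => by cases k; exacts [hGint, hHint _]) hB
  -- Each atom goes to a single index `σ k` attaining the maximum, so the weights `q i` split `p`,
  -- and the bound on `-g` at an atom of group `i` is a bound on `-g_i`.
  choose σ hσ using fun k => exists_eq_ciSup_of_finite (f := fun i => D.g i (z k))
  set q : Fin I → ι → ℝ := fun i k => if σ k = i then p k else 0 with hq
  have hq0 : ∀ i, ∀ k ∈ s, 0 ≤ q i k := fun i k hk => by
    simp only [hq]; split_ifs; exacts [hp k hk, le_rfl]
  have hsum : ∀ a : ι → ℝ, ∑ i, ∑ k ∈ s, q i k * a k = ∑ k ∈ s, p k * a k := fun a => by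
    rw [Finset.sum_comm]
    exact Finset.sum_congr rfl fun k _ => by simp [hq]
  let x : Var d I J := (fun i => - ∑ k ∈ s, q i k * G (z k), fun i => ∑ k ∈ s, q i k,
    fun i j => ∑ k ∈ s, q i k * H j (z k), fun i => ∑ k ∈ s, q i k • z k)
  refine ⟨x, ⟨fun i => Finset.sum_nonneg (hq0 i), ?_, fun j => ?_, fun i l => ?_, fun i j => ?_,
    fun i => ?_⟩, ?_⟩
  · have := hsum fun _ => 1
    simp only [mul_one, hp1] at this
    exact this
  · exact (hsum _).trans_le ((hquad (some j)).trans_le (hHle j))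
  · have := convexPerspective_sum_le (a := fun _ => 0) (hD.c_reg l) (hq0 i)
      (fun k hk _ => by simpa using (hzB k hk).1 l)
    simp only [mul_zero, Finset.sum_const_zero] at this
    exact this
  · exact convexPerspective_sum_le (hD.h_reg j) (hq0 i) (fun k hk _ => (hzB k hk).2.1 j)
  · have := convexPerspective_sum_le (a := fun k => G (z k)) (hD.g_reg i) (hq0 i)
      (fun k hk h0 => by
        have hk' : σ k = i := by by_contra h; exact h0 (if_neg h)
        have h3 := (hzB k hk).2.2
        rw [Data.disutility, ← hσ k, hk'] at h3
        exact h3)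
    rw [← neg_neg (∑ k ∈ s, q i k * _)] at this
    exact this
  · have h1 : ∑ i, x.tau i = - ∑ k ∈ s, p k * G (z k) := by
      rw [← hsum, ← Finset.sum_neg_distrib]; rfl
    have h2 : ∑ k ∈ s, p k * G (z k) = ∫ z, G z ∂P := hquad none
    rw [h1, h2]
    linarith

/-! ### From feasible points to discrete distributions -/

theorem expectation_discrete_le {x : Var d I J} (hpos : ∀ i, 0 < x.lam i)
    {f : EuclideanSpace ℝ (Fin d) → EReal} (hf : Measurable f) (hbot : ∀ z, f z ≠ ⊥) {a : Fin I → ℝ}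
    (h : ∀ i, f ((x.lam i)⁻¹ • x.ups i) ≤ (((x.lam i)⁻¹ * a i : ℝ) : EReal)) :
    expectation ⊤ x.discrete f ≤ ((∑ i, a i : ℝ) : EReal) := by
  have hcoe : ∀ i, f ((x.lam i)⁻¹ • x.ups i) =
      ((f ((x.lam i)⁻¹ • x.ups i)).toReal : EReal) := fun i =>
    (EReal.coe_toReal ((h i).trans_lt (EReal.coe_lt_top _)).ne (hbot _)).symm
  have hint : ∀ i ∈ Finset.univ, Integrable (fun z => (f z).toReal)
      (ENNReal.ofReal (x.lam i) • Measure.dirac ((x.lam i)⁻¹ • x.ups i)) := fun i _ =>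
    (integrable_dirac (by simp)).smul_measure ENNReal.ofReal_ne_top
  -- `toReal` is a wrong majorant where `f = ⊤`, but `f` is finite at the atoms, which carry all the
  -- mass.
  have h1 : expectation ⊤ x.discrete f ≤ ((∫ z, (f z).toReal ∂x.discrete : ℝ) : EReal) := by
    refine expectation_le_integral (integrable_finsetSum_measure.2 hint) ?_ hf
    rw [ae_iff, Var.discrete, Measure.finsetSum_apply]
    refine Finset.sum_eq_zero fun i _ => ?_
    rw [Measure.smul_apply, Measure.dirac_apply, Set.indicator_of_notMem, smul_zero]
    exact not_not.2 (hcoe i).le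
  refine h1.trans ?_
  rw [Var.discrete, integral_finsetSum_measure hint]
  norm_cast
  refine Finset.sum_le_sum fun i _ => ?_
  rw [integral_smul_measure, integral_dirac, ENNReal.toReal_ofReal (hpos i).le, smul_eq_mul]
  have h2 := h i
  rw [hcoe i] at h2
  norm_cast at h2
  rwa [← div_eq_inv_mul, le_div_iff₀' (hpos i)] at h2

/-- A feasible point with positive weights induces a feasible discrete distribution. -/
theorem IsFeasiblePoint.discrete_mem [Nonempty (Fin I)] {D : Data d I J L} (hD : D.Regular)
    {x : Var d I J} (hx : IsFeasiblePoint D x) (hpos : ∀ i, 0 < x.lam i) :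
    x.discrete ∈ D.uqFeasible ∧ ((∑ i, x.tau i : ℝ) : EReal) ≤ D.uqObj x.discrete := by
  have hval : ∀ {f : EuclideanSpace ℝ (Fin d) → EReal} {i : Fin I} {r : ℝ},
      convexPerspective f (x.ups i) (x.lam i) ≤ (r : EReal) →
      f ((x.lam i)⁻¹ • x.ups i) ≤ (((x.lam i)⁻¹ * r : ℝ) : EReal) := fun {f i r} h => by
    rw [convexPerspective, if_pos (hpos i)] at h
    exact (coe_mul_le_coe_iff (hpos i)).1 h
  -- At the `i`-th atom, `g ≥ g_i ≥ τ_i / λ_i`.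
  have hobj : ((∑ i, x.tau i : ℝ) : EReal) ≤ D.uqObj x.discrete := by
    have h := expectation_discrete_le hpos hD.measurable_neg_disutility
      (fun z => by simpa using hD.disutility_ne_top z) (a := fun i => - x.tau i) fun i =>
        (EReal.neg_le_neg_iff.2 (show _ ≤ D.disutility _ from
          le_iSup (fun i => D.g i _) i)).trans (hval (hx.disutility i))
    rwa [expectation_top_neg, Finset.sum_neg_distrib, EReal.coe_neg, EReal.neg_le_neg_iff] at h
  refine ⟨⟨⟨⟨?_⟩, ?_, fun j => ?_⟩, ?_⟩, hobj⟩
  · simp only [Var.discrete, Measure.coe_finsetSum, Measure.coe_smul, Finset.sum_apply,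
      Pi.smul_apply, measure_univ, smul_eq_mul, mul_one]
    rw [← ENNReal.ofReal_sum_of_nonneg fun i _ => hx.lam_nonneg i, hx.sum_lam, ENNReal.ofReal_one]
  · have : ∀ i, (x.lam i)⁻¹ • x.ups i ∈ D.supportSet := fun i l => by
      simpa using hval (hx.support i l)
    simp [Var.discrete, this]
  · exact (expectation_discrete_le hpos (hD.measurable_h j) (hD.h_reg j).proper.1
      fun i => hval (hx.moment i j)).trans (by exact_mod_cast hx.total j)
  · exact ((EReal.bot_lt_coe _).trans_le hobj).ne'

theorem exists_mix_gt {a b δ : ℝ} (hδ : 0 < δ) :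
    ∃ θ₀ : ℝ, 0 < θ₀ ∧ θ₀ ≤ 1 ∧ ∀ θ, 0 < θ → θ ≤ θ₀ → b - δ ≤ θ * a + (1 - θ) * b := by
  -- The loss is at most `θ |a - b|`; the added `1` keeps the denominator positive when `a = b`.
  refine ⟨min 1 (δ / (|a - b| + 1)), lt_min one_pos (by positivity), min_le_left _ _,
    fun θ h0 h1 => ?_⟩
  have h2 : θ ≤ δ / (|a - b| + 1) := h1.trans (min_le_right _ _)
  rw [le_div_iff₀ (by positivity)] at h2
  nlinarith [neg_abs_le (a - b)]

end UncertaintyQuantification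

/-! ### Equality of the suprema and recovery of approximate solutions -/

open UncertaintyQuantification in
theorem mainTheorem8 {d I J L : ℕ} (D : UncertaintyQuantification.Data d I J L)
    (hD : D.Regular)
    (xS : UncertaintyQuantification.Var d I J)
    (hxS : D.finiteProgram.IsSlaterPoint xS)
    (hpos : ∀ i, 0 < xS.lam i) :
    UncertaintyQuantification.supValue D.uqFeasible D.uqObj =
      UncertaintyQuantification.supValue D.finiteProgram.feasible D.finiteProgram.obj ∧
    ∀ ε : ℝ, 0 < ε → ∀ x : UncertaintyQuantification.Var d I J,
      UncertaintyQuantification.IsEpsOptimal D.finiteProgram.feasible D.finiteProgram.obj ε x →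
      ∃ θ₀ : ℝ, 0 < θ₀ ∧ θ₀ ≤ 1 ∧ ∀ θ : ℝ, 0 < θ → θ ≤ θ₀ →
        (∀ i, 0 < UncertaintyQuantification.Var.lam (θ • xS + (1 - θ) • x) i) ∧
        UncertaintyQuantification.IsEpsOptimal D.uqFeasible D.uqObj (2 * ε)
          (UncertaintyQuantification.Var.discrete (θ • xS + (1 - θ) • x)) := by
  have hS : IsFeasiblePoint D xS := (mem_feasible_iff D xS).1 ⟨hxS.mem, EReal.coe_ne_bot _⟩
  have hI : Nonempty (Fin I) := by
    by_contra h
    rw [not_nonempty_iff] at h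
    simpa using hS.sum_lam
  have mix : ∀ x : Var d I J, IsFeasiblePoint D x → ∀ δ : ℝ, 0 < δ →
      ∃ θ₀ : ℝ, 0 < θ₀ ∧ θ₀ ≤ 1 ∧ ∀ θ : ℝ, 0 < θ → θ ≤ θ₀ →
        (∀ i, 0 < Var.lam (θ • xS + (1 - θ) • x) i) ∧
        Var.discrete (θ • xS + (1 - θ) • x) ∈ D.uqFeasible ∧
        ((∑ i, x.tau i - δ : ℝ) : EReal) ≤ D.uqObj (Var.discrete (θ • xS + (1 - θ) • x)) := by
    intro x hx δ hδ
    obtain ⟨θ₀, h0, h1, h⟩ := exists_mix_gt (a := ∑ i, xS.tau i) (b := ∑ i, x.tau i) hδ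
    refine ⟨θ₀, h0, h1, fun θ hθ0 hθ1 => ?_⟩
    have hlam : ∀ i, 0 < Var.lam (θ • xS + (1 - θ) • x) i := fun i =>
      add_pos_of_pos_of_nonneg (mul_pos hθ0 (hpos i))
        (mul_nonneg (sub_nonneg.2 (hθ1.trans h1)) (hx.lam_nonneg i))
    obtain ⟨hmem, hobj⟩ := (hS.combo hD hx hθ0.le (hθ1.trans h1)).discrete_mem hD hlam
    refine ⟨hlam, hmem, le_trans ?_ hobj⟩
    have htau : ∑ i, Var.tau (θ • xS + (1 - θ) • x) i =
        θ * ∑ i, xS.tau i + (1 - θ) * ∑ i, x.tau i := by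
      rw [Finset.mul_sum, Finset.mul_sum, ← Finset.sum_add_distrib]
      rfl
    rw [htau]
    exact_mod_cast h θ hθ0 hθ1
  have heq : supValue D.uqFeasible D.uqObj =
      supValue D.finiteProgram.feasible D.finiteProgram.obj := by
    apply le_antisymm
    · refine iSup₂_le fun P hP => EReal.ge_of_forall_gt_iff_ge.1 fun r hr => ?_
      obtain ⟨x, hx, hle⟩ := exists_feasiblePoint_of_lt hD hP.1 hr
      exact le_trans (EReal.coe_le_coe_iff.2 hle)
        (le_iSup₂_of_le x ((mem_feasible_iff D x).2 hx) le_rfl)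
    · refine iSup₂_le fun x hx => EReal.ge_of_forall_gt_iff_ge.1 fun r hr => ?_
      have hr' : r < ∑ i, x.tau i := EReal.coe_lt_coe_iff.1 hr
      -- The allowed loss is `∑ τ_i - r`, so the mixed distribution still attains at least `r`.
      obtain ⟨θ, h0, -, h⟩ := mix x ((mem_feasible_iff D x).1 hx) _ (sub_pos.2 hr')
      obtain ⟨-, hmem, hobj⟩ := h θ h0 le_rfl
      rw [sub_sub_cancel] at hobj
      exact hobj.trans (le_iSup₂_of_le _ hmem le_rfl)
  refine ⟨heq, fun ε hε x hx => ?_⟩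
  obtain ⟨hxmem, hfin, htop⟩ := hx
  have hxf := (mem_feasible_iff D x).1 hxmem
  -- A loss of at most `ε` gives `2ε`-optimality when the supremum is finite; a loss of at most `1 /
  -- (2ε)` leaves `1 / ε - 1 / (2ε) = 1 / (2ε)` when it is infinite.
  obtain ⟨θ₀, h0, h1, h⟩ := mix x hxf (min ε (1 / (2 * ε))) (by positivity)
  refine ⟨θ₀, h0, h1, fun θ hθ0 hθ1 => ?_⟩
  obtain ⟨hlam, hmem, hobj⟩ := h θ hθ0 hθ1
  refine ⟨hlam, hmem, fun hne => le_trans ?_ hobj, fun he => le_trans ?_ hobj⟩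
  · rw [heq] at hne ⊢
    have h2 : supValue D.finiteProgram.feasible D.finiteProgram.obj - (ε : EReal) ≤
      ((∑ i, x.tau i : ℝ) : EReal) := hfin hne
    have hle : ((∑ i, x.tau i : ℝ) : EReal) ≤
        supValue D.finiteProgram.feasible D.finiteProgram.obj := le_iSup₂_of_le x hxmem le_rfl
    have hbot := ((EReal.bot_lt_coe _).trans_le hle).ne'
    lift supValue D.finiteProgram.feasible D.finiteProgram.obj to ℝ using ⟨hne, hbot⟩ with v
    norm_cast at h2 ⊢
    linarith [min_le_left ε (1 / (2 * ε))]
  · rw [heq] at he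
    have h2 : ((1 / ε : ℝ) : EReal) ≤ ((∑ i, x.tau i : ℝ) : EReal) := htop he
    rw [EReal.coe_le_coe_iff] at h2 ⊢
    have h3 : 1 / ε = 1 / (2 * ε) + 1 / (2 * ε) := by field_simp; norm_num
    linarith [min_le_right ε (1 / (2 * ε))]
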